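/- Let $R$ be an associative ring with identity; modules are unital left $R$-modules unless said otherwise. A short exact sequence $0\to A\to B\to C\to 0$ of left $R$-modules is \emph{coneat exact} if it remains exact when tensored with any simple right $R$-module; a submodule $A\subseteq B$ is \emph{coneat} if $0\to A\to B\to B/A\to 0$ is coneat exact. A module $M$ is - \emph{coneat injective} if it is injective with respect to all coneat exact sequences; - \emph{quasi injective} if every homomorphism from a submodule of $M$ to $M$ extends to an endomorphism of $M$; - \emph{$N$-coneat injective} (for a module $N$) if every homomorphism $K\to M$ from a coneat submodule $K$ of $N$ extends to $N$; \emph{quasi coneat injective} if it is $M$-coneat injective; and \emph{in the class $\mathscr{M}$} if it is $R$-coneat injective; - \emph{coneat quasi injective} if it is fully invariant in its coneat injective envelope. (A coneat injective envelope of $M$ is a homomorphism $i: M\to E$ with $E$ coneat injective such that every homomorphism from $M$ to a coneat injective module factors through $i$ and every endomorphism $f$ of $E$ with $fi=i$ is an automorphism; fully invariant means $f(i(M))\subseteq i(M)$ for every endomorphism $f$ of $E$.) - \emph{absolutely coneat} if it is coneat in every module containing it as a submodule; - \emph{coneat regular} if every submodule of $M$ is coneat. The ring $R$ is \emph{coneat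 regular} if it is so as a left module over itself. Consider the following statements. 1. $R$ is a right SF-ring, i.e. every simple right $R$-module is flat. 2. Every coneat injective left $R$-module is injective. 3. Every coneat injective left $R$-module is quasi injective. 4. Every coneat quasi injective left $R$-module is quasi injective. 5. Every quasi coneat injective left $R$-module is quasi injective. 6. Every coneat injective left $R$-module is absolutely coneat. 7. All left $R$-modules are absolutely coneat. 8. Every left $R$-module is coneat regular. 9. All short exact sequences of left $R$-modules are coneat exact. 10. The ring $R$ is coneat regular. 11. All left $R$-modules in the class $\mathscr{M}$ are injective. 12. The ring $R$ is von Neumann regular, i.e. for every $a\in R$ there is $x\in R$ with $axa=a$. Then (1)–(11) are equivalent and (12) implies (1). If $R$ is commutative, then all the statements (1)–(12) are equivalent. -/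

import Mathlib

open scoped TensorProduct

universe u

section Tensor

variable (R : Type*) [Ring R] (S : Type*) [AddCommGroup S] [Module Rᵐᵒᵖ S]

/-- The relations `s r ⊗ a = s ⊗ r a` that cut out `S ⊗_R A` from `S ⊗_ℤ A`, for a right
`R`-module `S` (a module over `Rᵐᵒᵖ`, with `s r` written `op r • s`) and a left `R`-module `A`. -/
def balancedRelations (A : Type*) [AddCommGroup A] [Module R A] : AddSubgroup (S ⊗[ℤ] A) :=
  AddSubgroup.closure
    {x | ∃ (s : S) (r : R) (a : A), x = (MulOpposite.op r • s) ⊗ₜ[ℤ] a - s ⊗ₜ[ℤ] (r • a)}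

/-- The tensor product `S ⊗_R A` of a right `R`-module `S` and a left `R`-module `A` over a ring
`R` that need not be commutative. It is an abelian group. -/
abbrev BalancedTensor (A : Type*) [AddCommGroup A] [Module R A] : Type _ :=
  (S ⊗[ℤ] A) ⧸ balancedRelations R S A

variable {R} {A B : Type*} [AddCommGroup A] [Module R A] [AddCommGroup B] [Module R B]

theorem balancedRelations_le_comap (f : A →ₗ[R] B) :
    balancedRelations R S A ≤ (balancedRelations R S B).comap
      (f.toAddMonoidHom.toIntLinearMap.lTensor S).toAddMonoidHom := by
  refine (AddSubgroup.closure_le _).2 ?_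
  rintro _ ⟨s, r, a, rfl⟩
  refine AddSubgroup.subset_closure ⟨s, r, f a, ?_⟩
  simp

/-- The map `S ⊗_R f : S ⊗_R A → S ⊗_R B`, `s ⊗ a ↦ s ⊗ f a`. -/
def BalancedTensor.map (f : A →ₗ[R] B) : BalancedTensor R S A →+ BalancedTensor R S B :=
  QuotientAddGroup.map _ _ (f.toAddMonoidHom.toIntLinearMap.lTensor S).toAddMonoidHom
    (balancedRelations_le_comap S f)

end Tensor

/-- The sequence `0 → A → B → C → 0` given by `f` and `g` is exact. -/
def IsShortExact {A B C : Type*} [Zero C] (f : A → B) (g : B → C) : Prop :=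
  Function.Injective f ∧ Function.Exact f g ∧ Function.Surjective g

section Modules

variable (R : Type u) [Ring R]

/-- The right `R`-module `S` is flat: `S ⊗_R -` preserves injectivity of maps of left modules. -/
def IsFlatRightModule (S : Type u) [AddCommGroup S] [Module Rᵐᵒᵖ S] : Prop :=
  ∀ (A B : Type u) [AddCommGroup A] [Module R A] [AddCommGroup B] [Module R B] (f : A →ₗ[R] B),
    Function.Injective f → Function.Injective (BalancedTensor.map S f)

/-- `R` is a right SF-ring: every simple right `R`-module is flat. -/
def IsRightSFRing : Prop :=
  ∀ (S : Type u) [AddCommGroup S] [Module Rᵐᵒᵖ S], IsSimpleModule Rᵐᵒᵖ S → IsFlatRightModule R S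

/-- `R` is von Neumann regular. -/
def IsVonNeumannRegularRing : Prop :=
  ∀ a : R, ∃ x : R, a * x * a = a

/-- The sequence `0 → A → B → C → 0` of left modules is coneat exact: it is exact, and remains
exact when tensored with any simple right `R`-module. -/
def IsConeatExact {A B C : Type u} [AddCommGroup A] [Module R A] [AddCommGroup B] [Module R B]
    [AddCommGroup C] [Module R C] (f : A →ₗ[R] B) (g : B →ₗ[R] C) : Prop :=
  IsShortExact f g ∧
    ∀ (S : Type u) [AddCommGroup S] [Module Rᵐᵒᵖ S], IsSimpleModule Rᵐᵒᵖ S →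
      IsShortExact (BalancedTensor.map S f) (BalancedTensor.map S g)

/-- The submodule `K` is coneat in `N`: `0 → K → N → N/K → 0` is coneat exact. -/
def IsConeatSubmodule {N : Type u} [AddCommGroup N] [Module R N] (K : Submodule R N) : Prop :=
  IsConeatExact R K.subtype K.mkQ

variable (M : Type u) [AddCommGroup M] [Module R M]

/-- `M` is injective with respect to all coneat exact sequences. -/
def IsConeatInjective : Prop :=
  ∀ (A B C : Type u) [AddCommGroup A] [Module R A] [AddCommGroup B] [Module R B]
    [AddCommGroup C] [Module R C] (f : A →ₗ[R] B) (g : B →ₗ[R] C), IsConeatExact R f g →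
      ∀ φ : A →ₗ[R] M, ∃ ψ : B →ₗ[R] M, ψ ∘ₗ f = φ

/-- `M` is injective with respect to all exact sequences having `M` as middle term. -/
def IsQuasiInjective : Prop :=
  ∀ (K : Submodule R M) (φ : K →ₗ[R] M), ∃ ψ : M →ₗ[R] M, ψ ∘ₗ K.subtype = φ

/-- `M` is `N`-coneat injective: every map `K → M` from a coneat submodule `K` of `N` extends
to `N`. -/
def IsRelConeatInjective (N : Type u) [AddCommGroup N] [Module R N] : Prop :=
  ∀ K : Submodule R N, IsConeatSubmodule R K →
    ∀ φ : K →ₗ[R] M, ∃ ψ : N →ₗ[R] M, ψ ∘ₗ K.subtype = φ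

/-- `M` is quasi coneat injective: it is `M`-coneat injective. -/
def IsQuasiConeatInjective : Prop :=
  IsRelConeatInjective R M M

/-- The class `𝓜` of modules: those that are `R`-coneat injective. -/
def IsInClassM : Prop :=
  IsRelConeatInjective R M R

variable {M} in
/-- `i : M → E` is an envelope of `M` in the class of coneat injective modules. -/
def IsConeatInjectiveEnvelope {E : Type u} [AddCommGroup E] [Module R E] (i : M →ₗ[R] E) : Prop :=
  IsConeatInjective R E ∧
    (∀ (E' : Type u) [AddCommGroup E'] [Module R E'], IsConeatInjective R E' →
      ∀ j : M →ₗ[R] E', ∃ f : E →ₗ[R] E', f ∘ₗ i = j) ∧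
    ∀ f : E →ₗ[R] E, f ∘ₗ i = i → Function.Bijective f

/-- `M` is coneat quasi injective: it is fully invariant in its coneat injective envelope (which
is unique up to isomorphism). -/
def IsConeatQuasiInjective : Prop :=
  ∃ (E : Type u) (_ : AddCommGroup E) (_ : Module R E) (i : M →ₗ[R] E),
    IsConeatInjectiveEnvelope R i ∧
      ∀ f : E →ₗ[R] E, (LinearMap.range i).map f ≤ LinearMap.range i

/-- `M` is absolutely coneat: it is coneat in every module containing it as a submodule. -/
def IsAbsolutelyConeat : Prop :=
  ∀ (N : Type u) [AddCommGroup N] [Module R N] (i : M →ₗ[R] N), Function.Injective i →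
    IsConeatSubmodule R (LinearMap.range i)

/-- `M` is coneat regular: each of its submodules is coneat. -/
def IsConeatRegular : Prop :=
  ∀ K : Submodule R M, IsConeatSubmodule R K

end Modules

/-!
The bridge between flatness of right modules and injectivity of left modules is the character
module `S⁺ = Hom_ℤ(S, ℚ/ℤ)` of a right module `S`, which is a left module. By the adjunction
`Hom_R(A, S⁺) ≅ (S ⊗_R A)⁺` (`characterEquiv`), for simple `S` the module `S⁺` is coneat
injective, and if `S⁺` is injective then `S` is flat, because `ℚ/ℤ` is an injective cogenerator.
Hence, if coneat injective modules are injective, then `R` is a right SF-ring.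

Conversely, `S ⊗_R -` is right exact, so over a right SF-ring every short exact sequence is coneat
exact, and all the other conditions follow at once. Each of them leads back to "coneat injective
modules are injective" by one of three arguments:
* a coneat injective module is a retract of any injective module in which its image is coneat;
* if `M` and `E` are coneat injective, so is `M × E`, and if `M × E` is quasi injective then the
  isomorphism from the copy of `M` inside `E` to `M` extends to a retraction `E → M`;
* Baer's criterion needs only coneat left ideals.

If `R` is von Neumann regular, every finite subset of a left ideal `I` has a right unit in `I`.
Every element of `S ⊗_R I` then has the form `s ⊗ e`, with `s` its image in `S`, so that
`S ⊗_R I → S` is injective: left ideals are coneat. For commutative `R` and a maximal ideal `m`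
containing `{r | a r ∈ a² R}`, flatness of `R/m` gives `a = t a` with `t ∈ m`. Then `a (1 - t) = 0`
puts `1 - t` in `m`, which is impossible, so no such `m` exists and `a ∈ a² R`.
-/

/-! ### Tensor products over a noncommutative ring -/

section TensorLemmas

variable {R : Type*} [Ring R] (S : Type*) [AddCommGroup S] [Module Rᵐᵒᵖ S]
variable {A B C : Type*} [AddCommGroup A] [Module R A] [AddCommGroup B] [Module R B]
  [AddCommGroup C] [Module R C]

variable (R) in
/-- The class of an element of `S ⊗_ℤ A` in `S ⊗_R A`. -/
def BalancedTensor.mk (A : Type*) [AddCommGroup A] [Module R A] :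
    (S ⊗[ℤ] A) →+ BalancedTensor R S A :=
  QuotientAddGroup.mk' (balancedRelations R S A)

theorem BalancedTensor.mk_surjective : Function.Surjective (BalancedTensor.mk R S A) :=
  QuotientAddGroup.mk'_surjective _

theorem BalancedTensor.mk_eq_zero_iff (x : S ⊗[ℤ] A) :
    BalancedTensor.mk R S A x = 0 ↔ x ∈ balancedRelations R S A :=
  QuotientAddGroup.eq_zero_iff x

theorem BalancedTensor.map_mk (f : A →ₗ[R] B) (x : S ⊗[ℤ] A) :
    BalancedTensor.map S f (BalancedTensor.mk R S A x) =
      BalancedTensor.mk R S B (f.toAddMonoidHom.toIntLinearMap.lTensor S x) :=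
  rfl

theorem BalancedTensor.mk_smul_tmul (s : S) (r : R) (a : A) :
    BalancedTensor.mk R S A ((MulOpposite.op r • s) ⊗ₜ[ℤ] a) =
      BalancedTensor.mk R S A (s ⊗ₜ[ℤ] (r • a)) := by
  rw [← sub_eq_zero, ← map_sub, BalancedTensor.mk_eq_zero_iff]
  exact AddSubgroup.subset_closure ⟨s, r, a, rfl⟩

/-- A biadditive map on `S × A` that is balanced over `R` induces a map on `S ⊗_R A`. -/
def BalancedTensor.lift {G : Type*} [AddCommGroup G] (φ : S →+ A →+ G)
    (h : ∀ (s : S) (r : R) (a : A), φ (MulOpposite.op r • s) a = φ s (r • a)) :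
    BalancedTensor R S A →+ G :=
  QuotientAddGroup.lift (balancedRelations R S A)
    (TensorProduct.liftAddHom φ fun n s a => by
      rw [map_zsmul, map_zsmul]; rfl) <| by
    refine (AddSubgroup.closure_le _).2 ?_
    rintro _ ⟨s, r, a, rfl⟩
    change TensorProduct.liftAddHom φ _ _ = 0
    rw [map_sub, TensorProduct.liftAddHom_tmul, TensorProduct.liftAddHom_tmul, h, sub_self]

theorem BalancedTensor.map_surjective (g : B →ₗ[R] C) (hg : Function.Surjective g) :
    Function.Surjective (BalancedTensor.map S g) := by
  intro y
  obtain ⟨y, rfl⟩ := BalancedTensor.mk_surjective S y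
  obtain ⟨x, rfl⟩ :=
    LinearMap.lTensor_surjective S (g := g.toAddMonoidHom.toIntLinearMap) hg y
  exact ⟨BalancedTensor.mk R S B x, rfl⟩

/-- Balanced relations lift along a surjective map, relation by relation. -/
theorem balancedRelations_le_map (g : B →ₗ[R] C) (hg : Function.Surjective g) :
    balancedRelations R S C ≤ (balancedRelations R S B).map
      (g.toAddMonoidHom.toIntLinearMap.lTensor S).toAddMonoidHom := by
  refine (AddSubgroup.closure_le _).2 ?_
  rintro _ ⟨s, r, c, rfl⟩
  obtain ⟨b, rfl⟩ := hg c
  refine ⟨_, AddSubgroup.subset_closure ⟨s, r, b, rfl⟩, ?_⟩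
  simp

theorem BalancedTensor.map_exact (f : A →ₗ[R] B) (g : B →ₗ[R] C) (hfg : Function.Exact f g)
    (hg : Function.Surjective g) :
    Function.Exact (BalancedTensor.map S f) (BalancedTensor.map S g) := by
  have hex : Function.Exact (f.toAddMonoidHom.toIntLinearMap.lTensor S)
      (g.toAddMonoidHom.toIntLinearMap.lTensor S) := lTensor_exact S hfg hg
  intro y
  obtain ⟨y, rfl⟩ := BalancedTensor.mk_surjective S y
  constructor
  · intro hy
    rw [BalancedTensor.map_mk, BalancedTensor.mk_eq_zero_iff] at hy
    obtain ⟨z, hz, hzy⟩ := balancedRelations_le_map S g hg hy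
    obtain ⟨x, hx⟩ := (hex (y - z)).1 (by rw [map_sub, sub_eq_zero]; exact hzy.symm)
    refine ⟨BalancedTensor.mk R S A x, ?_⟩
    rw [BalancedTensor.map_mk, hx, map_sub, (BalancedTensor.mk_eq_zero_iff S z).2 hz, sub_zero]
  · rintro ⟨x, hx⟩
    obtain ⟨x, rfl⟩ := BalancedTensor.mk_surjective S x
    rw [← hx, BalancedTensor.map_mk, BalancedTensor.map_mk, (hex _).2 ⟨x, rfl⟩, map_zero]

end TensorLemmas

/-! ### Character modules of right modules -/

section Characters

variable (R : Type*) [Ring R] (S : Type*) [AddCommGroup S] [Module Rᵐᵒᵖ S]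

/-- The character module `S⁺ = Hom_ℤ(S, ℚ/ℤ)` of a right `R`-module `S`, with its left `R`-module
structure `(r χ)(s) = χ(s r)`. It is a type synonym, to keep this structure apart from the one that
`CharacterModule S` carries over a commutative ring. -/
def RightCharacterModule (_R : Type*) (S : Type*) [AddCommGroup S] : Type _ :=
  S →+ AddCircle (1 : ℚ)

instance : AddCommGroup (RightCharacterModule R S) :=
  inferInstanceAs (AddCommGroup (S →+ AddCircle (1 : ℚ)))

instance : Module R (RightCharacterModule R S) where
  smul r χ := AddMonoidHom.comp χ (DistribSMul.toAddMonoidHom S (MulOpposite.op r))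
  one_smul χ := AddMonoidHom.ext fun s => congrArg χ.toFun (one_smul Rᵐᵒᵖ s)
  mul_smul r t χ := AddMonoidHom.ext fun s =>
    congrArg χ.toFun (mul_smul (MulOpposite.op t) (MulOpposite.op r) s)
  smul_zero _ := rfl
  smul_add _ _ _ := rfl
  add_smul r t χ := AddMonoidHom.ext fun s =>
    (congrArg χ.toFun (add_smul (MulOpposite.op r) (MulOpposite.op t) s)).trans (χ.map_add' _ _)
  zero_smul χ := AddMonoidHom.ext fun s =>
    (congrArg χ.toFun (zero_smul Rᵐᵒᵖ s)).trans χ.map_zero'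

variable {R} {A B : Type*} [AddCommGroup A] [Module R A] [AddCommGroup B] [Module R B]

/-- The character of `S ⊗_R A` adjoint to `φ : A → S⁺`, sending `s ⊗ a` to `φ a s`. -/
def toCharacter (φ : A →ₗ[R] RightCharacterModule R S) :
    BalancedTensor R S A →+ AddCircle (1 : ℚ) :=
  BalancedTensor.lift S (AddMonoidHom.flip (φ.toAddMonoidHom : A →+ (S →+ AddCircle (1 : ℚ))))
    fun s r a => by
      have h := DFunLike.congr_fun (F := S →+ AddCircle (1 : ℚ)) (φ.map_smul r a) s
      exact h.symm

/-- The map `A → S⁺` adjoint to a character of `S ⊗_R A`. -/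
def ofCharacter (χ : BalancedTensor R S A →+ AddCircle (1 : ℚ)) :
    A →ₗ[R] RightCharacterModule R S where
  toFun a := AddMonoidHom.mk' (fun s => χ (BalancedTensor.mk R S A (s ⊗ₜ[ℤ] a))) fun s t => by
    rw [TensorProduct.add_tmul, map_add, map_add]
  map_add' a b := AddMonoidHom.ext fun s => by
    change χ (BalancedTensor.mk R S A (s ⊗ₜ[ℤ] (a + b))) =
      χ (BalancedTensor.mk R S A (s ⊗ₜ[ℤ] a)) + χ (BalancedTensor.mk R S A (s ⊗ₜ[ℤ] b))
    rw [TensorProduct.tmul_add, map_add, map_add]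
  map_smul' r a := AddMonoidHom.ext fun s =>
    congrArg χ (BalancedTensor.mk_smul_tmul S s r a).symm

/-- The adjunction `Hom_R(A, S⁺) ≃ (S ⊗_R A)⁺`. -/
def characterEquiv :
    (A →ₗ[R] RightCharacterModule R S) ≃ (BalancedTensor R S A →+ AddCircle (1 : ℚ)) where
  toFun := toCharacter S
  invFun := ofCharacter S
  left_inv _ := rfl
  right_inv χ := by
    refine AddMonoidHom.ext fun x => ?_
    obtain ⟨x, rfl⟩ := BalancedTensor.mk_surjective S x
    induction x with
    | zero => simp
    | tmul s a => rfl
    | add x y hx hy => rw [map_add, map_add, map_add, hx, hy]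

theorem characterEquiv_comp (f : A →ₗ[R] B) (ψ : B →ₗ[R] RightCharacterModule R S) :
    characterEquiv S (ψ ∘ₗ f) = (characterEquiv S ψ).comp (BalancedTensor.map S f) := by
  rw [← Equiv.eq_symm_apply]
  rfl

end Characters

/-! ### Coneat exactness and coneat injectivity -/

section Coneat

variable {R : Type u} [Ring R]

theorem extends_rightCharacterModule {S : Type u} [AddCommGroup S] [Module Rᵐᵒᵖ S] {A B : Type u}
    [AddCommGroup A] [Module R A] [AddCommGroup B] [Module R B] (f : A →ₗ[R] B)
    (hf : Function.Injective (BalancedTensor.map S f))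
    (φ : A →ₗ[R] RightCharacterModule R S) :
    ∃ ψ : B →ₗ[R] RightCharacterModule R S, ψ ∘ₗ f = φ := by
  obtain ⟨χ, hχ⟩ := (Module.Baer.of_divisible (AddCircle (1 : ℚ))).extension_property_addMonoidHom
    (BalancedTensor.map S f) hf (characterEquiv S φ)
  refine ⟨(characterEquiv S).symm χ, (characterEquiv S).injective ?_⟩
  rw [characterEquiv_comp, Equiv.apply_symm_apply, hχ]

theorem isConeatInjective_rightCharacterModule (S : Type u) [AddCommGroup S] [Module Rᵐᵒᵖ S]
    [hS : IsSimpleModule Rᵐᵒᵖ S] : IsConeatInjective R (RightCharacterModule R S) :=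
  fun _ _ _ _ _ _ _ _ _ f _ h φ => extends_rightCharacterModule f (h.2 S hS).1 φ

theorem isFlatRightModule_of_injective_character (S : Type u) [AddCommGroup S] [Module Rᵐᵒᵖ S]
    (h : Module.Injective R (RightCharacterModule R S)) : IsFlatRightModule R S := by
  intro A B _ _ _ _ f hf
  rw [injective_iff_map_eq_zero]
  intro x hx
  refine CharacterModule.eq_zero_of_character_apply fun χ => ?_
  obtain ⟨ψ, hψ⟩ := h.out f hf ((characterEquiv S).symm χ)
  have hχ : (characterEquiv S ψ).comp (BalancedTensor.map S f) = χ :=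
    (characterEquiv_comp S f ψ).symm.trans
      ((characterEquiv S).eq_symm_apply.1 (LinearMap.ext hψ))
  refine (DFunLike.congr_fun hχ x).symm.trans ?_
  rw [AddMonoidHom.comp_apply, hx, map_zero]

/-- Since tensor products are right exact, coneat exactness is a matter of injectivity only. -/
theorem isConeatExact_of_injective {A B C : Type u} [AddCommGroup A] [Module R A]
    [AddCommGroup B] [Module R B] [AddCommGroup C] [Module R C] {f : A →ₗ[R] B} {g : B →ₗ[R] C}
    (h : IsShortExact f g)
    (hinj : ∀ (S : Type u) [AddCommGroup S] [Module Rᵐᵒᵖ S], IsSimpleModule Rᵐᵒᵖ S →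
      Function.Injective (BalancedTensor.map S f)) : IsConeatExact R f g :=
  ⟨h, fun S _ _ hS => ⟨hinj S hS, BalancedTensor.map_exact S f g h.2.1 h.2.2,
    BalancedTensor.map_surjective S g h.2.2⟩⟩

theorem isShortExact_subtype_mkQ {N : Type u} [AddCommGroup N] [Module R N] (K : Submodule R N) :
    IsShortExact K.subtype K.mkQ :=
  ⟨K.injective_subtype, LinearMap.exact_subtype_mkQ K, K.mkQ_surjective⟩

theorem IsConeatInjective.isRelConeatInjective {M : Type u} [AddCommGroup M] [Module R M]
    (hM : IsConeatInjective R M) (N : Type u) [AddCommGroup N] [Module R N] :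
    IsRelConeatInjective R M N :=
  fun _ hK φ => hM _ _ _ _ _ hK φ

theorem isConeatInjective_of_injective {M : Type u} [AddCommGroup M] [Module R M]
    (hM : Module.Injective R M) : IsConeatInjective R M := by
  intro A B C _ _ _ _ _ _ f g h φ
  obtain ⟨ψ, hψ⟩ := hM.out f h.1.1 φ
  exact ⟨ψ, LinearMap.ext hψ⟩

theorem IsConeatInjective.prod {M N : Type u} [AddCommGroup M] [Module R M] [AddCommGroup N]
    [Module R N] (hM : IsConeatInjective R M) (hN : IsConeatInjective R N) :
    IsConeatInjective R (M × N) := by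
  intro A B C _ _ _ _ _ _ f g h φ
  obtain ⟨ψ, hψ⟩ := hM A B C f g h (LinearMap.fst R M N ∘ₗ φ)
  obtain ⟨θ, hθ⟩ := hN A B C f g h (LinearMap.snd R M N ∘ₗ φ)
  refine ⟨ψ.prod θ, LinearMap.ext fun a => Prod.ext ?_ ?_⟩
  · exact LinearMap.congr_fun hψ a
  · exact LinearMap.congr_fun hθ a

/-- A coneat injective module is its own coneat injective envelope. -/
theorem IsConeatInjective.isConeatQuasiInjective {M : Type u} [AddCommGroup M] [Module R M]
    (hM : IsConeatInjective R M) : IsConeatQuasiInjective R M := by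
  refine ⟨M, inferInstance, inferInstance, LinearMap.id,
    ⟨hM, fun E' _ _ _ j => ⟨j, rfl⟩, fun f hf => ?_⟩, fun f => ?_⟩
  · rw [LinearMap.comp_id] at hf
    rw [hf]
    exact Function.bijective_id
  · rw [LinearMap.range_id]
    exact le_top

variable (R) in
theorem exists_injective_embedding (M : Type u) [AddCommGroup M] [Module R M] :
    ∃ (E : Type u) (_ : AddCommGroup E) (_ : Module R E) (i : M →ₗ[R] E),
      Module.Injective R E ∧ Function.Injective i := by
  obtain ⟨P⟩ := CategoryTheory.EnoughInjectives.presentation (ModuleCat.of R M)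
  have := P.injective
  exact ⟨P.J, inferInstance, inferInstance, P.f.hom,
    Module.injective_module_of_injective_object R P.J,
    (ModuleCat.mono_iff_injective P.f).1 P.mono⟩

theorem injective_of_retract {M E : Type u} [AddCommGroup M] [Module R M] [AddCommGroup E]
    [Module R E] (hE : Module.Injective R E) (i : M →ₗ[R] E) (p : E →ₗ[R] M)
    (hp : ∀ m, p (i m) = m) : Module.Injective R M where
  out X Y _ _ _ _ f hf g := by
    obtain ⟨h, hh⟩ := hE.out f hf (i ∘ₗ g)
    exact ⟨p ∘ₗ h, fun x => by simp [hh, hp]⟩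

theorem IsConeatInjective.injective_of_isAbsolutelyConeat {M : Type u} [AddCommGroup M]
    [Module R M] (hM : IsConeatInjective R M) (h : IsAbsolutelyConeat R M) :
    Module.Injective R M := by
  obtain ⟨E, _, _, i, hE, hi⟩ := exists_injective_embedding R M
  obtain ⟨p, hp⟩ := hM _ _ _ _ _ (h E i hi) (LinearEquiv.ofInjective i hi).symm.toLinearMap
  refine injective_of_retract hE i p fun m => ?_
  have := LinearMap.congr_fun hp (LinearEquiv.ofInjective i hi m)
  simpa using this

/-- If every coneat injective module is quasi injective, a coneat injective `M` is a retract of any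
injective module `E` containing it, by quasi injectivity of `M × E`. -/
theorem IsConeatInjective.injective_of_forall_isQuasiInjective {M : Type u} [AddCommGroup M]
    [Module R M] (hM : IsConeatInjective R M)
    (h : ∀ (M : Type u) [AddCommGroup M] [Module R M],
      IsConeatInjective R M → IsQuasiInjective R M) : Module.Injective R M := by
  obtain ⟨E, _, _, i, hE, hi⟩ := exists_injective_embedding R M
  have hj : Function.Injective (LinearMap.inr R M E ∘ₗ i) :=
    LinearMap.inr_injective.comp hi
  obtain ⟨ψ, hψ⟩ := h (M × E) (hM.prod (isConeatInjective_of_injective hE)) _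
    (LinearMap.inl R M E ∘ₗ (LinearEquiv.ofInjective _ hj).symm.toLinearMap)
  refine injective_of_retract hE i (LinearMap.fst R M E ∘ₗ ψ ∘ₗ LinearMap.inr R M E) fun m => ?_
  have := LinearMap.congr_fun hψ (LinearEquiv.ofInjective _ hj m)
  simpa using congrArg Prod.fst this

theorem IsInClassM.injective_of_isConeatRegular {M : Type u} [AddCommGroup M] [Module R M]
    (hM : IsInClassM R M) (h : IsConeatRegular R R) : Module.Injective R M := by
  refine Module.Baer.injective fun I φ => ?_
  obtain ⟨ψ, hψ⟩ := hM I (h I) φ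
  exact ⟨ψ, fun x hx => LinearMap.congr_fun hψ ⟨x, hx⟩⟩

/-- A fully invariant submodule of an injective module is quasi injective. -/
theorem isQuasiInjective_of_fullyInvariant {M E : Type u} [AddCommGroup M] [Module R M]
    [AddCommGroup E] [Module R E] (hE : Module.Injective R E) (i : M →ₗ[R] E)
    (hi : Function.Injective i)
    (hinv : ∀ f : E →ₗ[R] E, (LinearMap.range i).map f ≤ LinearMap.range i) :
    IsQuasiInjective R M := by
  intro K φ
  obtain ⟨f, hf⟩ := hE.out (i ∘ₗ K.subtype) (hi.comp K.injective_subtype) (i ∘ₗ φ)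
  have hmem : ∀ m, f (i m) ∈ LinearMap.range i := fun m => hinv f ⟨i m, ⟨m, rfl⟩, rfl⟩
  refine ⟨(LinearEquiv.ofInjective i hi).symm.toLinearMap ∘ₗ
    (f ∘ₗ i).codRestrict (LinearMap.range i) hmem, LinearMap.ext fun k => ?_⟩
  change (LinearEquiv.ofInjective i hi).symm _ = φ k
  rw [LinearEquiv.symm_apply_eq]
  exact Subtype.ext (hf k)

theorem IsConeatQuasiInjective.isQuasiInjective {M : Type u} [AddCommGroup M] [Module R M]
    (hM : IsConeatQuasiInjective R M)
    (h : ∀ (M : Type u) [AddCommGroup M] [Module R M],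
      IsConeatInjective R M → Module.Injective R M) : IsQuasiInjective R M := by
  obtain ⟨E, _, _, i, ⟨hE, hfac, -⟩, hinv⟩ := hM
  -- `i` is injective because an embedding of `M` into an injective module factors through it.
  obtain ⟨E', _, _, j, hE', hj⟩ := exists_injective_embedding R M
  obtain ⟨f, rfl⟩ := hfac E' (isConeatInjective_of_injective hE') j
  exact isQuasiInjective_of_fullyInvariant (h E hE) i (Function.Injective.of_comp hj) hinv

end Coneat

/-! ### Von Neumann regular rings -/

section Regular

variable {R : Type u} [Ring R]

/-- In a von Neumann regular ring, finitely many elements of a left ideal have a common right unit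
in that ideal. -/
theorem IsVonNeumannRegularRing.exists_right_unit (hR : IsVonNeumannRegularRing R)
    (I : Submodule R R) (F : List I) : ∃ e ∈ I, ∀ a ∈ F, (a : R) * e = a := by
  induction F with
  | nil => exact ⟨0, I.zero_mem, by simp⟩
  | cons b F ih =>
    obtain ⟨e, he, hF⟩ := ih
    -- If `g` is a right unit of `b' = b (1 - e)`, then `1 - (1 - e) (1 - g)` is one of `b` and `F`.
    obtain ⟨x, hx⟩ := hR ((b : R) - b * e)
    have hb' : (b : R) - b * e ∈ I := I.sub_mem b.2 (I.smul_mem (b : R) he)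
    generalize hg : x * ((b : R) - b * e) = g
    have hgI : g ∈ I := hg ▸ I.smul_mem x hb'
    have hbg : ((b : R) - b * e) * g = b - b * e := by rw [← hg, ← mul_assoc, hx]
    refine ⟨e + g - e * g, I.sub_mem (I.add_mem he hgI) (I.smul_mem e hgI), ?_⟩
    intro a ha
    rcases List.mem_cons.1 ha with rfl | ha
    · calc (a : R) * (e + g - e * g) = a * e + ((a : R) - a * e) * g := by noncomm_ring
        _ = a := by rw [hbg]; abel
    · calc (a : R) * (e + g - e * g) = a * e + ((a : R) - a * e) * g := by noncomm_ring
        _ = a := by rw [hF a ha, sub_self, zero_mul, add_zero]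

variable (S : Type*) [AddCommGroup S] [Module Rᵐᵒᵖ S]

variable (R) in
/-- The map `S ⊗_R R → S`, `s ⊗ r ↦ s r`. -/
def balancedTensorAction : BalancedTensor R S R →+ S :=
  BalancedTensor.lift S
    (AddMonoidHom.flip (AddMonoidHom.mk' (fun r : R => DistribSMul.toAddMonoidHom S
      (MulOpposite.op r)) fun r t => AddMonoidHom.ext fun s => by simp [add_smul]))
    fun s r a => mul_smul (MulOpposite.op a) (MulOpposite.op r) s |>.symm

/-- A right unit `e ∈ I` of the finitely many elements of a left ideal `I` that occur in a tensor
turns it into the elementary tensor `s ⊗ e`, where `s` is its image in `S`. -/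
theorem BalancedTensor.exists_finite_eq_tmul (I : Submodule R R) (x : S ⊗[ℤ] I) :
    ∃ F : List I, ∀ e : I, (∀ a ∈ F, (a : R) * e = a) → BalancedTensor.mk R S I x =
      BalancedTensor.mk R S I (balancedTensorAction R S
        (BalancedTensor.map S I.subtype (BalancedTensor.mk R S I x)) ⊗ₜ[ℤ] e) := by
  induction x with
  | zero => exact ⟨[], fun e _ => by simp⟩
  | tmul s a =>
    refine ⟨[a], fun e he => ?_⟩
    have hae : (a : R) • e = a := Subtype.ext (he a (by simp))
    change _ = BalancedTensor.mk R S I ((MulOpposite.op (a : R) • s) ⊗ₜ[ℤ] e)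
    rw [BalancedTensor.mk_smul_tmul, hae]
  | add x y hx hy =>
    obtain ⟨F, hF⟩ := hx
    obtain ⟨G, hG⟩ := hy
    refine ⟨F ++ G, fun e he => ?_⟩
    simp only [map_add, TensorProduct.add_tmul]
    rw [← hF e fun a ha => he a (List.mem_append_left _ ha),
      ← hG e fun a ha => he a (List.mem_append_right _ ha)]

theorem IsVonNeumannRegularRing.isConeatRegular (hR : IsVonNeumannRegularRing R) :
    IsConeatRegular R R := by
  intro I
  refine isConeatExact_of_injective (isShortExact_subtype_mkQ I) fun S _ _ _ => ?_
  rw [injective_iff_map_eq_zero]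
  intro x hx
  obtain ⟨x, rfl⟩ := BalancedTensor.mk_surjective S x
  obtain ⟨F, hF⟩ := BalancedTensor.exists_finite_eq_tmul S I x
  obtain ⟨e, he, heF⟩ := hR.exists_right_unit I F
  rw [hF ⟨e, he⟩ heF, hx, map_zero, TensorProduct.zero_tmul, map_zero]

/-! ### Flatness of `R/m` -/

/-- For a right ideal `m`, the additive subgroup `m a` of the products `t a` with `t ∈ m`. -/
def rightIdealMul (m : Submodule Rᵐᵒᵖ R) (a : R) : AddSubgroup R :=
  m.toAddSubgroup.map (AddMonoidHom.mulRight a)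

/-- For a right ideal `m`, the map `R/m ⊗_R R a → R / m a`, `[r] ⊗ x ↦ [r x]`. -/
def quotientTensorSpan (m : Submodule Rᵐᵒᵖ R) (a : R) :
    BalancedTensor R (R ⧸ m) (Submodule.span R {a}) →+ R ⧸ rightIdealMul m a :=
  BalancedTensor.lift (R ⧸ m)
    (QuotientAddGroup.lift m.toAddSubgroup
      (AddMonoidHom.mk' (fun r : R => (QuotientAddGroup.mk' (rightIdealMul m a)).comp
        ((AddMonoidHom.mulLeft r).comp (Submodule.span R {a}).subtype.toAddMonoidHom))
        fun r t => AddMonoidHom.ext fun x => by simp [add_mul])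
      (fun r hr => AddMonoidHom.ext fun x => by
        obtain ⟨b, hb⟩ := Submodule.mem_span_singleton.1 x.2
        refine (QuotientAddGroup.eq_zero_iff _).2
          ⟨r * b, m.smul_mem (MulOpposite.op b) hr, ?_⟩
        change r * b * a = r * (x : R)
        rw [← hb, smul_eq_mul, mul_assoc]))
    fun s r x => by
      obtain ⟨s, rfl⟩ := m.mkQ_surjective s
      exact congrArg (QuotientAddGroup.mk' (rightIdealMul m a)) (mul_assoc s r (x : R))

/-- If `m` is a right ideal with `R/m` flat, then `a ∈ m` implies `a ∈ m a`: the tensor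
`[1] ⊗ a ∈ R/m ⊗_R R a` vanishes in `R/m ⊗_R R = R/m`. -/
theorem exists_mul_eq_self_of_isFlatRightModule (m : Submodule Rᵐᵒᵖ R)
    (hm : IsFlatRightModule R (R ⧸ m)) {a : R} (ha : a ∈ m) : ∃ t ∈ m, t * a = a := by
  have hinj := hm _ _ (Submodule.span R {a}).subtype (Submodule.injective_subtype _)
  let a' : Submodule.span R {a} := ⟨a, Submodule.mem_span_singleton_self a⟩
  have h0 : BalancedTensor.mk R (R ⧸ m) (Submodule.span R {a}) (m.mkQ 1 ⊗ₜ[ℤ] a') = 0 := by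
    apply hinj
    rw [map_zero, BalancedTensor.map_mk]
    change BalancedTensor.mk R (R ⧸ m) R (m.mkQ 1 ⊗ₜ[ℤ] a) = 0
    have h := BalancedTensor.mk_smul_tmul (R ⧸ m) (m.mkQ 1) a (1 : R)
    rw [smul_eq_mul, mul_one, ← map_smul] at h
    rw [← h, op_smul_eq_mul, one_mul, Submodule.mkQ_apply,
      (Submodule.Quotient.mk_eq_zero m).2 ha, TensorProduct.zero_tmul, map_zero]
  have h1 := congrArg (quotientTensorSpan m a) h0
  rw [map_zero] at h1
  obtain ⟨t, ht, hta⟩ := (QuotientAddGroup.eq_zero_iff (N := rightIdealMul m a) ((1 : R) * a)).1 h1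
  exact ⟨t, ht, by simpa using hta⟩

theorem IsRightSFRing.isVonNeumannRegularRing_of_comm (hR : IsRightSFRing R)
    (hcomm : ∀ a b : R, a * b = b * a) : IsVonNeumannRegularRing R := by
  intro a
  -- the right ideal `{r | a r ∈ a² R}`
  let J : Submodule Rᵐᵒᵖ R :=
    { carrier := {r | ∃ x, a * a * x = a * r}
      add_mem' := by
        rintro r t ⟨x, hx⟩ ⟨y, hy⟩
        exact ⟨x + y, by rw [mul_add, mul_add, hx, hy]⟩
      zero_mem' := ⟨0, by simp⟩
      smul_mem' := by
        rintro c r ⟨x, hx⟩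
        exact ⟨x * c.unop, by rw [← mul_assoc, hx, mul_assoc]; rfl⟩ }
  by_cases hJ : J = ⊤
  · obtain ⟨x, hx⟩ : (1 : R) ∈ J := hJ ▸ Submodule.mem_top
    exact ⟨x, by rw [mul_assoc, hcomm x a, ← mul_assoc, hx, mul_one]⟩
  · exfalso
    have : Module.Finite Rᵐᵒᵖ R := ⟨⟨{1}, by
      rw [eq_top_iff]
      intro r _
      rw [Finset.coe_singleton, Submodule.mem_span_singleton]
      exact ⟨MulOpposite.op r, by simp⟩⟩⟩
    obtain ⟨m, hm, hJm⟩ := (eq_top_or_exists_le_coatom J).resolve_left hJ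
    obtain ⟨t, ht, hta⟩ := exists_mul_eq_self_of_isFlatRightModule m
      (hR (R ⧸ m) (isSimpleModule_iff_isCoatom.2 hm)) (hJm ⟨1, by rw [mul_one]⟩ : a ∈ m)
    have h1t : 1 - t ∈ m := hJm ⟨0, by rw [mul_sub, hcomm a t, hta, mul_zero, mul_one, sub_self]⟩
    have h1 : (1 : R) ∈ m := by simpa using m.add_mem h1t ht
    refine hm.1 (eq_top_iff.2 fun r _ => ?_)
    simpa using m.smul_mem (MulOpposite.op r) h1

end Regular

/-! ### The equivalences -/

theorem mainTheorem2 (R : Type u) [Ring R] :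
    List.TFAE [
      IsRightSFRing R,
      ∀ (M : Type u) [AddCommGroup M] [Module R M], IsConeatInjective R M → Module.Injective R M,
      ∀ (M : Type u) [AddCommGroup M] [Module R M], IsConeatInjective R M → IsQuasiInjective R M,
      ∀ (M : Type u) [AddCommGroup M] [Module R M],
        IsConeatQuasiInjective R M → IsQuasiInjective R M,
      ∀ (M : Type u) [AddCommGroup M] [Module R M],
        IsQuasiConeatInjective R M → IsQuasiInjective R M,
      ∀ (M : Type u) [AddCommGroup M] [Module R M], IsConeatInjective R M → IsAbsolutelyConeat R M,
      ∀ (M : Type u) [AddCommGroup M] [Module R M], IsAbsolutelyConeat R M,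
      ∀ (M : Type u) [AddCommGroup M] [Module R M], IsConeatRegular R M,
      ∀ (A B C : Type u) [AddCommGroup A] [Module R A] [AddCommGroup B] [Module R B]
        [AddCommGroup C] [Module R C] (f : A →ₗ[R] B) (g : B →ₗ[R] C),
        IsShortExact f g → IsConeatExact R f g,
      IsConeatRegular R R,
      ∀ (M : Type u) [AddCommGroup M] [Module R M], IsInClassM R M → Module.Injective R M] ∧
    -- one implication holds for every ring
    (IsVonNeumannRegularRing R → IsRightSFRing R) ∧
    -- for commutative rings von Neumann regularity is equivalent to each of the above
    ((∀ a b : R, a * b = b * a) → (IsVonNeumannRegularRing R ↔ IsRightSFRing R)) := by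
  refine (and_iff_left_of_imp fun htfae => ?_).2 ?_
  · have h := (htfae.out 9 0).1
    exact ⟨fun hR => h hR.isConeatRegular, fun hcomm =>
      ⟨fun hR => h hR.isConeatRegular, fun hR => hR.isVonNeumannRegularRing_of_comm hcomm⟩⟩
  tfae_have 1 → 9 := fun h A B C _ _ _ _ _ _ f g hfg =>
    isConeatExact_of_injective hfg fun S _ _ hS => h S hS A B f hfg.1
  tfae_have 9 → 8 := fun h M _ _ K => h _ _ _ _ _ (isShortExact_subtype_mkQ K)
  tfae_have 8 → 7 := fun h M _ _ N _ _ i _ => h N (LinearMap.range i)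
  tfae_have 7 → 6 := fun h M _ _ _ => h M
  tfae_have 6 → 2 := fun h M _ _ hM => hM.injective_of_isAbsolutelyConeat (h M hM)
  tfae_have 2 → 1 := fun h S _ _ hS => isFlatRightModule_of_injective_character S
    (h _ (isConeatInjective_rightCharacterModule S))
  tfae_have 8 → 10 := fun h => h R
  tfae_have 10 → 11 := fun h M _ _ hM => hM.injective_of_isConeatRegular h
  tfae_have 11 → 2 := fun h M _ _ hM => h M (hM.isRelConeatInjective R)
  tfae_have 8 → 5 := fun h M _ _ hM K φ => hM K (h M K) φ
  tfae_have 5 → 3 := fun h M _ _ hM => h M (hM.isRelConeatInjective M)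
  tfae_have 2 → 4 := fun h M _ _ hM => hM.isQuasiInjective h
  tfae_have 4 → 3 := fun h M _ _ hM => h M hM.isConeatQuasiInjective
  tfae_have 3 → 2 := fun h M _ _ hM => hM.injective_of_forall_isQuasiInjective h
  tfae_finish
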